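/- Let $\mathcal H$ be a complex Hilbert space and let $A,B\in\mathcal B(\mathcal H)$ satisfy $mI\le A\le MI$ and $mI\le B\le MI$ in the Loewner order, for some real numbers $0<m<M$. Let $v\in[0,1]$. For positive invertible $X,Y\in\mathcal B(\mathcal H)$ put $X\nabla_vY=(1-v)X+vY$ and $X\,!_v\,Y=\big((1-v)X^{-1}+vY^{-1}\big)^{-1}$, and for positive reals $a,b$ put $a\nabla_vb=(1-v)a+vb$, $a\sharp_vb=a^{1-v}b^v$, $a\,!_v\,b=\big((1-v)a^{-1}+vb^{-1}\big)^{-1}$. Let $\sigma_v$ and $\tau_v$ be two operator means in the sense of Kubo and Ando (binary operations on the positive operators that are jointly monotone, satisfy the transformer inequality $C(X\sigma Y)C\le (CXC)\sigma(CYC)$ for $C\ge0$, are continuous along decreasing sequences in the strong operator topology, and satisfy $I\sigma I=I$) lying between the harmonic and the arithmetic mean of weight $v$, that is, $X\,!_v\,Y\le X\sigma_vY\le X\nabla_vY$ and $X\,!_v\,Y\le X\tau_vY\le X\nabla_vY$ for all positive invertible $X,Y\in\mathcal B(\mathcal H)$. Let $f:(0,\infty)\to(0,\infty)$ be an operator monotone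 (increasing) function, i.e. $f$ is continuous and $X\le Y$ implies $f(X)\le f(Y)$ for all positive invertible operators $X,Y$ on any complex Hilbert space. Then $$f(A)\,\sigma_v\,f(B)\le f\big(L(m,M)\,(A\,\tau_v\,B)\big)\qquad\text{and}\qquad f\Big(\tfrac1{L(m,M)}\,(A\,\sigma_v\,B)\Big)\le f(A)\,\tau_v\,f(B),$$ where $$L(m,M)=\frac{(m\nabla_\lambda M)\,(m\sharp_\mu M)}{(m\sharp_\lambda M)\,(m\,!_\mu\,M)},\qquad \lambda=\min\{v,1-v\},\quad \mu=\max\{v,1-v\}.$$ -/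

import Mathlib

open scoped Topology

universe u

noncomputable section

/-- Scalar weighted arithmetic mean `a ∇_v b`. -/
def scalarArith (v a b : ℝ) : ℝ := (1 - v) * a + v * b

/-- Scalar weighted geometric mean `a ♯_v b`, for `a, b > 0`. -/
def scalarGeom (v a b : ℝ) : ℝ := a ^ (1 - v) * b ^ v

/-- Scalar weighted harmonic mean `a !_v b`, for `a, b > 0`. -/
def scalarHarm (v a b : ℝ) : ℝ := ((1 - v) * a⁻¹ + v * b⁻¹)⁻¹

/-- The constant `L(m, M)` belonging to the weight `v`, with `λ = min {v, 1 - v}` and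
`μ = max {v, 1 - v}`. -/
def constL (v m M : ℝ) : ℝ :=
  (scalarArith (min v (1 - v)) m M * scalarGeom (max v (1 - v)) m M) /
    (scalarGeom (min v (1 - v)) m M * scalarHarm (max v (1 - v)) m M)

/-- `f` is operator monotone (increasing) on `(0, ∞)`: it is continuous there, and `A ≤ B` implies
`f(A) ≤ f(B)` for all positive invertible operators (equivalently, self-adjoint operators with
spectrum in `(0, ∞)`) on every complex Hilbert space, finite or infinite dimensional.
Here `f(A)` is the continuous functional calculus and `≤` is the Loewner order. -/
def IsOperatorMonotone (f : ℝ → ℝ) : Prop :=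
  ContinuousOn f (Set.Ioi 0) ∧
    ∀ (K : Type u) [NormedAddCommGroup K] [InnerProductSpace ℂ K] [CompleteSpace K]
      (A B : K →L[ℂ] K), IsStrictlyPositive A → IsStrictlyPositive B → A ≤ B →
        cfc f A ≤ cfc f B

section Operators

variable {H : Type*} [NormedAddCommGroup H] [InnerProductSpace ℂ H] [CompleteSpace H]

/-- Weighted arithmetic mean of operators, `A ∇_v B = (1 - v) A + v B`. -/
def opArith (v : ℝ) (A B : H →L[ℂ] H) : H →L[ℂ] H := (1 - v) • A + v • B

/-- Weighted harmonic mean of positive invertible operators,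
`A !_v B = ((1 - v) A⁻¹ + v B⁻¹)⁻¹`. -/
def opHarm (v : ℝ) (A B : H →L[ℂ] H) : H →L[ℂ] H :=
  Ring.inverse ((1 - v) • Ring.inverse A + v • Ring.inverse B)

/-- Operator means in the sense of Kubo and Ando: binary operations on the positive operators on
`H` that are jointly monotone, satisfy the transformer inequality, are continuous from above for
the strong operator topology, and are normalized. Values at operators that are not positive
play no role. -/
structure IsOperatorMean (σ : (H →L[ℂ] H) → (H →L[ℂ] H) → (H →L[ℂ] H)) : Prop where
  nonneg : ∀ A B : H →L[ℂ] H, 0 ≤ A → 0 ≤ B → 0 ≤ σ A B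
  mono : ∀ A B C D : H →L[ℂ] H, 0 ≤ A → 0 ≤ B → A ≤ C → B ≤ D → σ A B ≤ σ C D
  transformer : ∀ A B C : H →L[ℂ] H, 0 ≤ A → 0 ≤ B → 0 ≤ C →
    C * σ A B * C ≤ σ (C * A * C) (C * B * C)
  continuous_above : ∀ (A B : ℕ → H →L[ℂ] H) (A₀ B₀ : H →L[ℂ] H),
    (∀ n, 0 ≤ A n) → (∀ n, 0 ≤ B n) → Antitone A → Antitone B →
    (∀ x, Filter.Tendsto (fun n => A n x) Filter.atTop (𝓝 (A₀ x))) →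
    (∀ x, Filter.Tendsto (fun n => B n x) Filter.atTop (𝓝 (B₀ x))) →
    ∀ x, Filter.Tendsto (fun n => σ (A n) (B n) x) Filter.atTop (𝓝 (σ A₀ B₀ x))
  normalized : σ 1 1 = 1

/-- The operation `σ` lies between the weighted harmonic and arithmetic means of weight `v`, on
positive invertible operators. -/
def BetweenHarmArith (v : ℝ) (σ : (H →L[ℂ] H) → (H →L[ℂ] H) → (H →L[ℂ] H)) : Prop :=
  ∀ A B : H →L[ℂ] H, IsStrictlyPositive A → IsStrictlyPositive B →
    opHarm v A B ≤ σ A B ∧ σ A B ≤ opArith v A B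

end Operators

end

/-!
The two inequalities follow from three facts about a weight `v ∈ [0, 1]`. Write `∇` and `!` for the
arithmetic and harmonic means of weight `v`.

* `opArith_le_smul_opHarm` and `arithHarmRatio_le_constL`: `A ∇ B ≤ L • (A ! B)` if the spectra of
  `A` and `B` lie in `[m, M]`. Conjugation by `A ^ (-1 / 2)` reduces this to the pair `(1, T)` with
  `m / M ≤ T ≤ M / m`, where it is a scalar inequality. The sharp constant is
  `(1 - v + v h) (1 - v + v / h)` with `h = M / m`, and it is at most `L` by a one-variable
  monotonicity argument.
* `IsOperatorMonotone.opArith_cfc_le`: an operator monotone function on the half-line is operator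
  concave, `f(A) ∇ f(B) ≤ f(A ∇ B)`. Rotating `diag(A, B)` on `H ⊕ H` by the angle with
  `cos² = 1 - v` gives an operator matrix with first corner `A ∇ B`, which is dominated by
  `diag(A ∇ B + ε, R)` for large `R`. Apply `f`, compress to the first corner and let `ε → 0`.
* `IsOperatorMonotone.cfc_opHarm_le`: `f(A ! B) ≤ f(A) ! f(B)`, which is operator concavity of the
  operator monotone function `x ↦ 1 / f(1 / x)`, applied to the inverses.

Then `f(A) σ f(B) ≤ f(A) ∇ f(B) ≤ f(A ∇ B) ≤ f(L (A ! B)) ≤ f(L (A τ B))`, and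
`f(L⁻¹ (A σ B)) ≤ f(L⁻¹ (A ∇ B)) ≤ f(A ! B) ≤ f(A) ! f(B) ≤ f(A) τ f(B)`.
-/

/-! ### The scalar constant -/

/-- The scalar inequality behind `arithHarmRatio v m M ≤ constL v m M`, with `r = 1 - 2 v` and
`h = M / m`. Both sides agree at `h = 1`, and the difference is increasing in `h`. -/
theorem one_add_mul_add_le_rpow_mul {r h : ℝ} (hr₀ : 0 ≤ r) (hr₁ : r ≤ 1) (hh : 1 ≤ h) :
    (1 + r) * h + (1 - r) ≤ h ^ r * ((1 - r) * h + (1 + r)) := by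
  have hmono : MonotoneOn
      (fun x : ℝ => x ^ r * ((1 - r) * x + (1 + r)) - ((1 + r) * x + (1 - r)))
      (Set.Ici 1) := by
    have hd : ∀ x : ℝ, 1 ≤ x → HasDerivAt
        (fun x : ℝ => x ^ r * ((1 - r) * x + (1 + r)) - ((1 + r) * x + (1 - r)))
        (r * x ^ (r - 1) * ((1 - r) * x + (1 + r)) + x ^ r * (1 - r) - (1 + r)) x := by
      intro x hx
      have h₁ := Real.hasDerivAt_rpow_const (x := x) (p := r) (Or.inl (by positivity))
      have h₂ := ((hasDerivAt_id x).const_mul (1 - r)).add_const (1 + r)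
      have h₃ := ((hasDerivAt_id x).const_mul (1 + r)).add_const (1 - r)
      convert! (h₁.mul h₂).sub h₃ using 1
      simp
    refine monotoneOn_of_deriv_nonneg (convex_Ici 1)
      (fun x hx => (hd x hx).continuousAt.continuousWithinAt)
      (fun x hx => (hd x (interior_subset hx)).differentiableAt.differentiableWithinAt) ?_
    intro x hx
    have hx : 1 ≤ x := interior_subset hx
    have hx₀ : 0 < x := by linarith
    rw [(hd x hx).deriv]
    have hxr : x ^ r = x ^ (r - 1) * x := by
      rw [← Real.rpow_add_one hx₀.ne', sub_add_cancel]
    -- Up to the factor `1 + r`, the derivative is the weighted AM-GM defect of `x` and `1`.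
    have hone : 1 ≤ x ^ (r - 1) * ((1 - r) * x + r) := by
      have := Real.geom_mean_le_arith_mean2_weighted (by linarith : 0 ≤ 1 - r) hr₀ hx₀.le
        zero_le_one (by ring)
      rw [Real.one_rpow, mul_one, mul_one] at this
      calc (1 : ℝ) = x ^ (r - 1) * x ^ (1 - r) := by
            rw [← Real.rpow_add hx₀]; simp
        _ ≤ _ := by gcongr
    rw [hxr]
    nlinarith
  have := hmono (Set.mem_Ici.2 le_rfl) hh hh
  simp only [Real.one_rpow] at this
  linarith

/-- The largest ratio of the arithmetic mean of weight `v` to the harmonic mean of weight `v` on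
pairs of numbers from `[m, M]`; it is attained at `(m, M)`. -/
noncomputable def arithHarmRatio (v m M : ℝ) : ℝ :=
  ((1 - v) + v * (M / m)) * ((1 - v) + v * (m / M))

theorem arithHarmRatio_one_sub (v : ℝ) {m M : ℝ} (hm : 0 < m) (hM : 0 < M) :
    arithHarmRatio (1 - v) m M = arithHarmRatio v m M := by
  unfold arithHarmRatio
  field_simp
  ring

theorem arithHarmRatio_pos {v m M : ℝ} (hv : v ∈ Set.Icc (0 : ℝ) 1) (hm : 0 < m) (hM : 0 < M) :
    0 < arithHarmRatio v m M := by
  have key : ∀ t : ℝ, 0 < t → 0 < (1 - v) + v * t := fun t ht => by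
    rcases hv.1.eq_or_lt with rfl | hv₀
    · simp
    · have := mul_pos hv₀ ht
      linarith [hv.2]
  exact mul_pos (key _ (by positivity)) (key _ (by positivity))

theorem constL_one_sub (v m M : ℝ) : constL (1 - v) m M = constL v m M := by
  unfold constL
  rw [sub_sub_cancel, min_comm, max_comm]

theorem arithHarmRatio_le_constL {v m M : ℝ} (hv : v ∈ Set.Icc (0 : ℝ) 1) (hm : 0 < m)
    (hmM : m < M) : arithHarmRatio v m M ≤ constL v m M := by
  -- Both sides are invariant under `v ↦ 1 - v`.
  wlog hv₂ : v ≤ 1 / 2 generalizing v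
  · rw [← arithHarmRatio_one_sub v hm (hm.trans hmM), ← constL_one_sub]
    exact this ⟨by linarith [hv.2], by linarith [hv.1]⟩ (by linarith)
  have hM : 0 < M := hm.trans hmM
  have hh₁ : 1 ≤ M / m := (one_le_div hm).2 hmM.le
  have hh : 0 < M / m := by positivity
  have key := one_add_mul_add_le_rpow_mul (r := 1 - 2 * v) (by linarith) (by linarith [hv.1]) hh₁
  have hL : constL v m M =
      ((1 - v) + v * (M / m)) * ((M / m) ^ (1 - 2 * v) * (v + (1 - v) * (m / M))) := by
    have hgeom : ∀ w, scalarGeom w m M = m * (M / m) ^ w := fun w => by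
      unfold scalarGeom
      rw [Real.rpow_sub hm, Real.div_rpow hM.le hm.le, Real.rpow_one]
      ring
    unfold constL
    rw [min_eq_left (by linarith), max_eq_right (by linarith), hgeom, hgeom,
      show 1 - v = (1 - 2 * v) + v by ring, Real.rpow_add hh]
    unfold scalarArith scalarHarm
    have hp : (M / m) ^ v ≠ 0 := (Real.rpow_pos_of_pos hh _).ne'
    field_simp
    ring
  rw [hL, arithHarmRatio]
  have hpos : 0 ≤ (1 - v) + v * (M / m) := by
    have := mul_nonneg hv.1 hh.le
    linarith [hv.2]
  refine mul_le_mul_of_nonneg_left ?_ hpos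
  have hinv : m / M = (M / m)⁻¹ := (inv_div M m).symm
  rw [hinv]
  generalize M / m = h at *
  rw [← mul_le_mul_iff_of_pos_right hh]
  have e₁ : ((1 - v) + v * h⁻¹) * h = (1 - v) * h + v := by field_simp
  have e₂ : h ^ (1 - 2 * v) * (v + (1 - v) * h⁻¹) * h =
      h ^ (1 - 2 * v) * (v * h + (1 - v)) := by field_simp
  rw [e₁, e₂]
  linarith

theorem mul_le_arithHarmRatio {v m M t : ℝ} (hv : v ∈ Set.Icc (0 : ℝ) 1) (hm : 0 < m)
    (hmM : m < M) (ht₁ : m / M ≤ t) (ht₂ : t ≤ M / m) :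
    ((1 - v) + v * t) * ((1 - v) + v * t⁻¹) ≤ arithHarmRatio v m M := by
  have hM : 0 < M := hm.trans hmM
  have ht : 0 < t := lt_of_lt_of_le (by positivity) ht₁
  -- `t + t⁻¹` on an interval symmetric under inversion is largest at the endpoints.
  have hsum : t + t⁻¹ ≤ M / m + m / M := by
    have h₁ : 0 ≤ (t - m / M) * (M / m - t) :=
      mul_nonneg (by linarith) (by linarith)
    have h₂ : (t - m / M) * (M / m - t) = (M / m + m / M - (t + t⁻¹)) * t := by
      field_simp
      ring
    rw [h₂] at h₁
    have := nonneg_of_mul_nonneg_left h₁ ht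
    linarith
  have e₁ : ((1 - v) + v * t) * ((1 - v) + v * t⁻¹) =
      (1 - v) ^ 2 + v ^ 2 + v * (1 - v) * (t + t⁻¹) := by
    field_simp
    ring
  have e₂ : arithHarmRatio v m M =
      (1 - v) ^ 2 + v ^ 2 + v * (1 - v) * (M / m + m / M) := by
    unfold arithHarmRatio
    field_simp
    ring
  rw [e₁, e₂]
  have : 0 ≤ v * (1 - v) := mul_nonneg hv.1 (by linarith [hv.2])
  gcongr

/-! ### Reversing the operator arithmetic-harmonic mean inequality -/

section Means

variable {H : Type*} [NormedAddCommGroup H] [InnerProductSpace ℂ H] [CompleteSpace H]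

theorem IsStrictlyPositive.opArith {v : ℝ} {A B : H →L[ℂ] H} (hv : v ∈ Set.Icc (0 : ℝ) 1)
    (hA : IsStrictlyPositive A) (hB : IsStrictlyPositive B) :
    IsStrictlyPositive (opArith v A B) := by
  rcases hv.1.eq_or_lt with rfl | hv₀
  · simpa [_root_.opArith] using hA
  · exact IsStrictlyPositive.nonneg_add (smul_nonneg (by linarith [hv.2]) hA.nonneg)
      (hB.smul hv₀)

theorem IsStrictlyPositive.opHarm {v : ℝ} {A B : H →L[ℂ] H} (hv : v ∈ Set.Icc (0 : ℝ) 1)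
    (hA : IsStrictlyPositive A) (hB : IsStrictlyPositive B) :
    IsStrictlyPositive (opHarm v A B) :=
  (hA.ringInverse.opArith hv hB.ringInverse).ringInverse

/-- The reversed inequality for a commuting pair, where it is the scalar inequality on the
spectrum. -/
theorem opArith_one_le_smul_opHarm_one {T : H →L[ℂ] H} {m M v : ℝ} (hm : 0 < m) (hmM : m < M)
    (hT : IsStrictlyPositive T) (hT₁ : (m / M) • (1 : H →L[ℂ] H) ≤ T)
    (hT₂ : T ≤ (M / m) • (1 : H →L[ℂ] H)) (hv : v ∈ Set.Icc (0 : ℝ) 1) :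
    opArith v 1 T ≤ arithHarmRatio v m M • opHarm v 1 T := by
  have hsa : IsSelfAdjoint T := hT.isSelfAdjoint
  have hspec₁ : ∀ t ∈ spectrum ℝ T, m / M ≤ t := by
    rwa [← Algebra.algebraMap_eq_smul_one, algebraMap_le_iff_le_spectrum (ha := hsa)] at hT₁
  have hspec₂ : ∀ t ∈ spectrum ℝ T, t ≤ M / m := by
    rwa [← Algebra.algebraMap_eq_smul_one, le_algebraMap_iff_spectrum_le (ha := hsa)] at hT₂
  have hpos : ∀ t ∈ spectrum ℝ T, 0 < t := fun t ht => hT.spectrum_pos ht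
  have hcinv : ContinuousOn (fun t : ℝ => t⁻¹) (spectrum ℝ T) :=
    continuousOn_id.inv₀ fun t ht => (hpos t ht).ne'
  have hcharm : ContinuousOn (fun t : ℝ => (1 - v) + v * t⁻¹) (spectrum ℝ T) :=
    continuousOn_const.add (continuousOn_const.mul hcinv)
  have hharm_pos : ∀ t ∈ spectrum ℝ T, 0 < (1 - v) + v * t⁻¹ := fun t ht => by
    have := inv_pos.2 (hpos t ht)
    rcases hv.1.eq_or_lt with rfl | hv₀
    · simp
    · have := mul_pos hv₀ this
      linarith [hv.2]
  have hcid : ContinuousOn (fun t : ℝ => t) (spectrum ℝ T) := continuousOn_id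
  have hcont : ContinuousOn (fun t : ℝ => ((1 - v) + v * t⁻¹)⁻¹) (spectrum ℝ T) :=
    hcharm.inv₀ fun t ht => (hharm_pos t ht).ne'
  have harith : opArith v 1 T = cfc (fun t : ℝ => (1 - v) + v * t) T := by
    rw [cfc_const_add (1 - v) (fun t => v * t) T (continuousOn_const.mul hcid) hsa,
      cfc_const_mul_id v T hsa, Algebra.algebraMap_eq_smul_one, opArith]
  have hharm : opHarm v 1 T = cfc (fun t : ℝ => ((1 - v) + v * t⁻¹)⁻¹) T := by
    rw [cfc_inv (fun t : ℝ => (1 - v) + v * t⁻¹) T (fun t ht => (hharm_pos t ht).ne') hcharm hsa,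
      cfc_const_add (1 - v) (fun t => v * t⁻¹) T (continuousOn_const.mul hcinv) hsa,
      cfc_const_mul v (fun t => t⁻¹) T hcinv,
      cfc_inv (fun t : ℝ => t) T (fun t ht => (hpos t ht).ne') hcid hsa, cfc_id' ℝ T hsa,
      Algebra.algebraMap_eq_smul_one, opHarm, Ring.inverse_one]
  rw [harith, hharm, ← cfc_const_mul _ _ T hcont]
  refine cfc_mono (fun t ht => ?_) (continuousOn_const.add (continuousOn_const.mul hcid))
    (continuousOn_const.mul hcont)
  rw [← div_eq_mul_inv, le_div_iff₀ (hharm_pos t ht)]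
  exact mul_le_arithHarmRatio hv hm hmM (hspec₁ t ht) (hspec₂ t ht)

/-- The reversed arithmetic-harmonic mean inequality for operators with spectra in `[m, M]`. -/
theorem opArith_le_smul_opHarm {A B : H →L[ℂ] H} {m M v : ℝ} (hm : 0 < m) (hmM : m < M)
    (hmA : m • (1 : H →L[ℂ] H) ≤ A) (hAM : A ≤ M • (1 : H →L[ℂ] H))
    (hmB : m • (1 : H →L[ℂ] H) ≤ B) (hBM : B ≤ M • (1 : H →L[ℂ] H))
    (hv : v ∈ Set.Icc (0 : ℝ) 1) :
    opArith v A B ≤ arithHarmRatio v m M • opHarm v A B := by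
  have hM : 0 < M := hm.trans hmM
  have hA : IsStrictlyPositive A := (isStrictlyPositive_one.smul hm).of_le hmA
  have hB : IsStrictlyPositive B := (isStrictlyPositive_one.smul hm).of_le hmB
  -- Conjugating by `A ^ (1 / 2)` reduces the claim to the pair `(1, T)`.
  set T := CFC.conjSqrt (Ring.inverse A) B with hT_def
  have hAinv := hA.ringInverse
  have hT : IsStrictlyPositive T :=
    (CFC.isStrictlyPositive_conjSqrt_iff _ _ hAinv).2 hB
  have hBT : CFC.conjSqrt A T = B := CFC.conjSqrt_conjSqrt_ringInverse _ _ hA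
  have hA1 : CFC.conjSqrt A 1 = A := CFC.conjSqrt_one A hA.nonneg
  have hTA : CFC.conjSqrt (Ring.inverse A) A = 1 := CFC.conjSqrt_ringInverse_self A hA
  have hT₁ : (m / M) • (1 : H →L[ℂ] H) ≤ T := by
    rw [← hTA, ← map_smul]
    refine CFC.conjSqrt_monotone (le_trans ?_ hmB)
    calc (m / M) • A ≤ (m / M) • M • (1 : H →L[ℂ] H) :=
          smul_le_smul_of_nonneg_left hAM (by positivity)
      _ = m • 1 := by rw [smul_smul, div_mul_cancel₀ _ hM.ne']
  have hT₂ : T ≤ (M / m) • (1 : H →L[ℂ] H) := by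
    rw [← hTA, ← map_smul]
    refine CFC.conjSqrt_monotone (hBM.trans ?_)
    calc M • (1 : H →L[ℂ] H) = (M / m) • m • 1 := by rw [smul_smul, div_mul_cancel₀ _ hm.ne']
      _ ≤ (M / m) • A := smul_le_smul_of_nonneg_left hmA (by positivity)
  have hle : opArith v 1 T ≤ arithHarmRatio v m M • opHarm v 1 T :=
    opArith_one_le_smul_opHarm_one hm hmM hT hT₁ hT₂ hv
  have hA_arith : opArith v A B = CFC.conjSqrt A (opArith v 1 T) := by
    simp only [opArith, map_add, map_smul, hA1, hBT]
  have hA_harm : opHarm v A B = CFC.conjSqrt A (opHarm v 1 T) := by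
    have hinv : CFC.conjSqrt (Ring.inverse A) (Ring.inverse T) = Ring.inverse B := by
      rw [← CFC.ringInverse_conjSqrt A T hA, hBT]
    have hinv1 : CFC.conjSqrt (Ring.inverse A) 1 = Ring.inverse A :=
      CFC.conjSqrt_one _ hAinv.nonneg
    have hAA : Ring.inverse (Ring.inverse A) = A := by
      obtain ⟨u, rfl⟩ := hA.isUnit
      rw [Ring.inverse_unit, Ring.inverse_unit, inv_inv]
    rw [opHarm, opHarm, ← hinv, Ring.inverse_one]
    nth_rw 1 [← hinv1]
    rw [← map_smul, ← map_smul, ← map_add, CFC.ringInverse_conjSqrt _ _ hAinv, hAA]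
  rw [hA_arith, hA_harm, ← map_smul]
  exact CFC.conjSqrt_monotone hle

end Means

/-! ### Orthogonal pairs of isometries -/

open ContinuousLinearMap in
/-- Isometries `W₁, W₂ : H → K` with `K = W₁ H ⊕ W₂ H` an orthogonal direct sum. Such a pair
identifies operators on `K` with `2 × 2` matrices of operators on `H`. -/
structure IsOrthogonalPair {H K : Type*} [NormedAddCommGroup H] [InnerProductSpace ℂ H]
    [CompleteSpace H] [NormedAddCommGroup K] [InnerProductSpace ℂ K] [CompleteSpace K]
    (W₁ W₂ : H →L[ℂ] K) : Prop where
  adjoint_comp_self_left : adjoint W₁ ∘L W₁ = 1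
  adjoint_comp_self_right : adjoint W₂ ∘L W₂ = 1
  adjoint_left_comp_right : adjoint W₁ ∘L W₂ = 0
  adjoint_right_comp_left : adjoint W₂ ∘L W₁ = 0
  comp_adjoint_add : W₁ ∘L adjoint W₁ + W₂ ∘L adjoint W₂ = 1

namespace IsOrthogonalPair

open ContinuousLinearMap

variable {H K : Type*} [NormedAddCommGroup H] [InnerProductSpace ℂ H]
    [CompleteSpace H] [NormedAddCommGroup K] [InnerProductSpace ℂ K] [CompleteSpace K]
    {W₁ W₂ : H →L[ℂ] K}

/-- The block diagonal operator `W₁ X W₁* + W₂ Y W₂*`, as a star homomorphism in `(X, Y)`. -/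
noncomputable def blockDiag (h : IsOrthogonalPair W₁ W₂) :
    ((H →L[ℂ] H) × (H →L[ℂ] H)) →⋆ₐ[ℂ] (K →L[ℂ] K) where
  toFun X := W₁ ∘L X.1 ∘L adjoint W₁ + W₂ ∘L X.2 ∘L adjoint W₂
  map_one' := h.comp_adjoint_add
  map_zero' := by simp
  map_add' X Y := by
    simp only [Prod.fst_add, Prod.snd_add, add_comp, comp_add]
    abel
  map_mul' X Y := by
    have h₁ (x : H) : adjoint W₁ (W₁ x) = x := congr($(h.adjoint_comp_self_left) x)
    have h₂ (x : H) : adjoint W₂ (W₂ x) = x := congr($(h.adjoint_comp_self_right) x)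
    have h₃ (x : H) : adjoint W₁ (W₂ x) = 0 := congr($(h.adjoint_left_comp_right) x)
    have h₄ (x : H) : adjoint W₂ (W₁ x) = 0 := congr($(h.adjoint_right_comp_left) x)
    ext x
    simp [h₁, h₂, h₃, h₄]
  commutes' c := by
    have h₁ (x : K) : W₁ (adjoint W₁ x) + W₂ (adjoint W₂ x) = x :=
      congr($(h.comp_adjoint_add) x)
    ext x
    simp [Algebra.algebraMap_eq_smul_one, ← smul_add, h₁]
  map_star' X := by
    simp [star_eq_adjoint, adjoint_comp, comp_assoc]

theorem blockDiag_apply (h : IsOrthogonalPair W₁ W₂) (X Y : H →L[ℂ] H) :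
    h.blockDiag (X, Y) = W₁ ∘L X ∘L adjoint W₁ + W₂ ∘L Y ∘L adjoint W₂ := rfl

theorem adjoint_comp_blockDiag_comp (h : IsOrthogonalPair W₁ W₂) (X Y : H →L[ℂ] H) :
    adjoint W₁ ∘L h.blockDiag (X, Y) ∘L W₁ = X := by
  have h₁ (x : H) : adjoint W₁ (W₁ x) = x := congr($(h.adjoint_comp_self_left) x)
  have h₄ (x : H) : adjoint W₂ (W₁ x) = 0 := congr($(h.adjoint_right_comp_left) x)
  ext x
  simp [blockDiag_apply, h₁, h₄]

theorem isStrictlyPositive_blockDiag (h : IsOrthogonalPair W₁ W₂) {X Y : H →L[ℂ] H}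
    (hX : IsStrictlyPositive X) (hY : IsStrictlyPositive Y) :
    IsStrictlyPositive (h.blockDiag (X, Y)) := by
  refine IsUnit.isStrictlyPositive ?_ ?_
  · exact (Prod.isUnit_iff.2 ⟨hX.isUnit, hY.isUnit⟩).map h.blockDiag
  · rw [nonneg_iff_isPositive, blockDiag_apply]
    exact (((nonneg_iff_isPositive _).1 hX.nonneg).conj_adjoint W₁).add
      (((nonneg_iff_isPositive _).1 hY.nonneg).conj_adjoint W₂)

theorem cfc_blockDiag (h : IsOrthogonalPair W₁ W₂) {f : ℝ → ℝ} {X Y : H →L[ℂ] H}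
    (hX : IsStrictlyPositive X) (hY : IsStrictlyPositive Y)
    (hf : ContinuousOn f (Set.Ioi 0)) :
    cfc f (h.blockDiag (X, Y)) = h.blockDiag (cfc f X, cfc f Y) := by
  have hspec : ContinuousOn f (spectrum ℝ X ∪ spectrum ℝ Y) :=
    hf.mono (Set.union_subset (fun x hx => hX.spectrum_pos hx) (fun x hx => hY.spectrum_pos hx))
  have : ContinuousFunctionalCalculus ℝ ((H →L[ℂ] H) × (H →L[ℂ] H)) IsSelfAdjoint :=
    IsSelfAdjoint.instContinuousFunctionalCalculus
  have hXY : IsSelfAdjoint (X, Y) := Prod.ext hX.isSelfAdjoint hY.isSelfAdjoint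
  have hcont : Continuous h.blockDiag := by
    change Continuous fun X : (H →L[ℂ] H) × (H →L[ℂ] H) =>
      W₁ ∘L X.1 ∘L adjoint W₁ + W₂ ∘L X.2 ∘L adjoint W₂
    fun_prop
  rw [← cfc_map_prod (S := ℂ) f X Y hspec hXY hX.isSelfAdjoint hY.isSelfAdjoint]
  refine (h.blockDiag.map_cfc f (X, Y) ?_ hcont hXY
    (h.isStrictlyPositive_blockDiag hX hY).isSelfAdjoint).symm
  rwa [Prod.spectrum_eq]

theorem adjoint_real_smul (r : ℝ) (S : H →L[ℂ] K) : adjoint (r • S) = r • adjoint S := by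
  have h₁ : r • S = (r : ℂ) • S := (Complex.coe_smul r S).symm
  have h₂ : r • adjoint S = (r : ℂ) • adjoint S := (Complex.coe_smul r _).symm
  rw [h₁, h₂, map_smulₛₗ, Complex.conj_ofReal]

theorem rotate (h : IsOrthogonalPair W₁ W₂) {s t : ℝ} (hst : s ^ 2 + t ^ 2 = 1) :
    IsOrthogonalPair (s • W₁ - t • W₂) (t • W₁ + s • W₂) := by
  constructor <;>
  simp only [map_sub, map_add, adjoint_real_smul, comp_sub, comp_add, sub_comp, add_comp,
    comp_smul, smul_comp, h.adjoint_comp_self_left, h.adjoint_comp_self_right,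
    h.adjoint_left_comp_right, h.adjoint_right_comp_left]
  · match_scalars <;> linear_combination hst
  · match_scalars <;> linear_combination hst
  · module
  · module
  · rw [← h.comp_adjoint_add]
    match_scalars <;> first | linear_combination hst | ring

/-- The matrix entries, in the frame `W₁, W₂`, of an operator that is block diagonal in the frame
obtained by a rotation with `cos² = 1 - v` and `sin² = v`. -/
theorem blockDiag_rotate {v : ℝ} (hv : v ∈ Set.Icc (0 : ℝ) 1)
    (hV : IsOrthogonalPair (√(1 - v) • W₁ - √v • W₂) (√v • W₁ + √(1 - v) • W₂))
    (X Y : H →L[ℂ] H) : hV.blockDiag (X, Y) =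
      W₁ ∘L opArith v X Y ∘L adjoint W₁
        + W₁ ∘L ((√(1 - v) * √v) • (Y - X)) ∘L adjoint W₂
        + W₂ ∘L ((√(1 - v) * √v) • (Y - X)) ∘L adjoint W₁
        + W₂ ∘L opArith v Y X ∘L adjoint W₂ := by
  have hs : √(1 - v) ^ 2 = 1 - v := Real.sq_sqrt (by linarith [hv.2])
  have ht : √v ^ 2 = v := Real.sq_sqrt hv.1
  have hX : opArith v X Y = √(1 - v) ^ 2 • X + √v ^ 2 • Y := by rw [hs, ht, opArith]
  have hY : opArith v Y X = √(1 - v) ^ 2 • Y + √v ^ 2 • X := by rw [hs, ht, opArith]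
  rw [blockDiag_apply, hX, hY]
  simp only [map_sub, map_add, adjoint_real_smul, comp_sub, comp_add,
    sub_comp, add_comp, comp_smul, smul_comp]
  module

theorem adjoint_comp_blockDiag_rotate_comp (hW : IsOrthogonalPair W₁ W₂) {v : ℝ}
    (hv : v ∈ Set.Icc (0 : ℝ) 1)
    (hV : IsOrthogonalPair (√(1 - v) • W₁ - √v • W₂) (√v • W₁ + √(1 - v) • W₂))
    (X Y : H →L[ℂ] H) :
    adjoint W₁ ∘L hV.blockDiag (X, Y) ∘L W₁ = opArith v X Y := by
  have h₁ (x : H) : adjoint W₁ (W₁ x) = x := congr($(hW.adjoint_comp_self_left) x)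
  have h₃ (x : H) : adjoint W₁ (W₂ x) = 0 := congr($(hW.adjoint_left_comp_right) x)
  have h₄ (x : H) : adjoint W₂ (W₁ x) = 0 := congr($(hW.adjoint_right_comp_left) x)
  rw [blockDiag_rotate hv hV]
  ext x
  simp only [comp_apply, add_apply, h₁, h₃, h₄, map_add, map_zero, add_zero]

/-- A self-adjoint `2 × 2` operator matrix is dominated by a diagonal one with first entry
enlarged by any `ε > 0`, if the second diagonal entry is taken large enough. -/
theorem exists_le_blockDiag (hW : IsOrthogonalPair W₁ W₂) {C D E : H →L[ℂ] H}
    (hD : IsSelfAdjoint D) (hE : IsSelfAdjoint E) {ε : ℝ} (hε : 0 < ε) :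
    ∃ R : ℝ, 0 < R ∧
      W₁ ∘L C ∘L adjoint W₁ + W₁ ∘L D ∘L adjoint W₂ + W₂ ∘L D ∘L adjoint W₁
        + W₂ ∘L E ∘L adjoint W₂ ≤ hW.blockDiag (C + ε • 1, R • 1) := by
  have hD' : adjoint D = D := hD
  -- The difference is `ε S* S` plus a block diagonal term holding the Schur complement `R - F`.
  set F := E + ε⁻¹ • (D ∘L D) with hF_def
  have hF : IsSelfAdjoint F := by
    refine hE.add (IsSelfAdjoint.smul (IsSelfAdjoint.all _) ?_)
    rw [IsSelfAdjoint, star_eq_adjoint, adjoint_comp, hD']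
  refine ⟨‖F‖ + 1, by positivity, ?_⟩
  have hFR : 0 ≤ (‖F‖ + 1) • 1 - F := by
    have h₁ : F ≤ ‖F‖ • 1 := by
      rw [← Algebra.algebraMap_eq_smul_one]
      exact hF.le_algebraMap_norm_self
    rw [add_smul, one_smul, add_sub_right_comm]
    exact add_nonneg (sub_nonneg.2 h₁) zero_le_one
  generalize ‖F‖ + 1 = R at hFR ⊢
  set S := adjoint W₁ - ε⁻¹ • (D ∘L adjoint W₂) with hS_def
  have hS : adjoint S = W₁ - ε⁻¹ • (W₂ ∘L D) := by
    rw [hS_def, map_sub, adjoint_real_smul, adjoint_comp, hD', adjoint_adjoint, adjoint_adjoint]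
  have hone (X : K →L[ℂ] H) : (1 : H →L[ℂ] H) ∘L X = X := rfl
  have key : hW.blockDiag (C + ε • 1, R • 1) -
      (W₁ ∘L C ∘L adjoint W₁ + W₁ ∘L D ∘L adjoint W₂ + W₂ ∘L D ∘L adjoint W₁
        + W₂ ∘L E ∘L adjoint W₂) =
      ε • (adjoint S ∘L S) + W₂ ∘L (R • 1 - F) ∘L adjoint W₂ := by
    rw [hS, blockDiag_apply, hS_def, hF_def]
    simp only [comp_sub, comp_add, sub_comp, add_comp, comp_smul, smul_comp, hone, comp_assoc]
    match_scalars <;> field_simp <;> ring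
  rw [le_def, key]
  refine IsPositive.add ?_ (((nonneg_iff_isPositive _).1 hFR).conj_adjoint W₂)
  rw [← Complex.coe_smul]
  exact (isPositive_adjoint_comp_self S).smul_of_nonneg (by exact_mod_cast hε.le)

theorem exists_blockDiag_rotate_le (hW : IsOrthogonalPair W₁ W₂) {v : ℝ}
    (hv : v ∈ Set.Icc (0 : ℝ) 1)
    (hV : IsOrthogonalPair (√(1 - v) • W₁ - √v • W₂) (√v • W₁ + √(1 - v) • W₂))
    {A B : H →L[ℂ] H} (hA : IsStrictlyPositive A) (hB : IsStrictlyPositive B)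
    {ε : ℝ} (hε : 0 < ε) :
    ∃ R : ℝ, 0 < R ∧ hV.blockDiag (A, B) ≤ hW.blockDiag (opArith v A B + ε • 1, R • 1) := by
  rw [blockDiag_rotate hv hV]
  exact hW.exists_le_blockDiag
    (IsSelfAdjoint.smul (IsSelfAdjoint.all _) (hB.isSelfAdjoint.sub hA.isSelfAdjoint))
    (hB.opArith hv hA).isSelfAdjoint hε

/-- The coordinate inclusions into `H ⊕ H` form an orthogonal pair. The sum lies in the universe of
`H`, which is where `IsOperatorMonotone` quantifies over Hilbert spaces. -/
theorem exists_pair (H : Type u) [NormedAddCommGroup H] [InnerProductSpace ℂ H]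
    [CompleteSpace H] :
    ∃ V₁ V₂ : H →L[ℂ] WithLp 2 (H × H), IsOrthogonalPair V₁ V₂ := by
  let e := (WithLp.prodContinuousLinearEquiv 2 ℂ H H).symm.toContinuousLinearMap
  let V₁ : H →L[ℂ] WithLp 2 (H × H) := e ∘L ContinuousLinearMap.inl ℂ H H
  let V₂ : H →L[ℂ] WithLp 2 (H × H) := e ∘L ContinuousLinearMap.inr ℂ H H
  have h₁ : adjoint V₁ = WithLp.fstL 2 ℂ H H := by
    symm
    rw [eq_adjoint_iff]
    intro x y
    simp [V₁, e, WithLp.prod_inner_apply]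
  have h₂ : adjoint V₂ = WithLp.sndL 2 ℂ H H := by
    symm
    rw [eq_adjoint_iff]
    intro x y
    simp [V₂, e, WithLp.prod_inner_apply]
  refine ⟨V₁, V₂, ?_⟩
  constructor <;> simp only [h₁, h₂]
  · ext x; simp [V₁, e]
  · ext x; simp [V₂, e]
  · ext x; simp [V₂, e]
  · ext x; simp [V₁, e]
  · refine ContinuousLinearMap.ext fun x => (WithLp.equiv 2 (H × H)).injective ?_
    ext <;> simp [V₁, V₂, e]

end IsOrthogonalPair

/-! ### Operator monotone functions are operator concave -/

namespace IsOperatorMonotone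

open ContinuousLinearMap

variable {H : Type u} [NormedAddCommGroup H] [InnerProductSpace ℂ H] [CompleteSpace H]
  {f : ℝ → ℝ}

/-- Operator concavity up to `ε`: the block diagonal operator of `A, B` in the rotated frame has first
corner `opArith v A B` in the original frame, where it is dominated by a block diagonal operator;
operator monotonicity on `H ⊕ H` and compression to the first corner give the claim. -/
theorem opArith_cfc_le_cfc_add (hf : IsOperatorMonotone.{u} f) {A B : H →L[ℂ] H}
    (hA : IsStrictlyPositive A) (hB : IsStrictlyPositive B) {v : ℝ}
    (hv : v ∈ Set.Icc (0 : ℝ) 1) {ε : ℝ} (hε : 0 < ε) :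
    opArith v (cfc f A) (cfc f B) ≤ cfc f (opArith v A B + ε • 1) := by
  obtain ⟨W₁, W₂, hW⟩ := IsOrthogonalPair.exists_pair H
  have hst : √(1 - v) ^ 2 + √v ^ 2 = 1 := by
    rw [Real.sq_sqrt (by linarith [hv.2]), Real.sq_sqrt hv.1]
    ring
  have hV := hW.rotate hst
  obtain ⟨R, hR₀, hle⟩ := hW.exists_blockDiag_rotate_le hv hV hA hB hε
  have hC : IsStrictlyPositive (opArith v A B + ε • (1 : H →L[ℂ] H)) :=
    (hA.opArith hv hB).add_nonneg (smul_nonneg hε.le zero_le_one)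
  have hR : IsStrictlyPositive (R • (1 : H →L[ℂ] H)) := isStrictlyPositive_one.smul hR₀
  have hmono := hf.2 _ _ _ (hV.isStrictlyPositive_blockDiag hA hB)
    (hW.isStrictlyPositive_blockDiag hC hR) hle
  rw [hV.cfc_blockDiag hA hB hf.1, hW.cfc_blockDiag hC hR hf.1] at hmono
  have hcompress := ((le_def _ _).1 hmono).adjoint_conj W₁
  rwa [sub_comp, comp_sub, hW.adjoint_comp_blockDiag_rotate_comp hv,
    hW.adjoint_comp_blockDiag_comp, ← le_def] at hcompress

/-- Operator monotone functions on the half-line are operator concave. -/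
theorem opArith_cfc_le (hf : IsOperatorMonotone.{u} f) {A B : H →L[ℂ] H}
    (hA : IsStrictlyPositive A) (hB : IsStrictlyPositive B) {v : ℝ}
    (hv : v ∈ Set.Icc (0 : ℝ) 1) :
    opArith v (cfc f A) (cfc f B) ≤ cfc f (opArith v A B) := by
  set C := opArith v A B
  have hC : IsStrictlyPositive C := hA.opArith hv hB
  have hlim : Filter.Tendsto (fun ε : ℝ => cfc f (C + ε • 1)) (𝓝[>] 0) (𝓝 (cfc f C)) := by
    nontriviality H →L[ℂ] H
    obtain ⟨r, hr, hrC⟩ := (CFC.exists_pos_algebraMap_le_iff (a := C) hC.isSelfAdjoint).2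
      fun x hx => hC.spectrum_pos hx
    have hsub : ∀ ε ∈ Set.Icc (0 : ℝ) 1, spectrum ℝ (C + ε • 1) ⊆ Set.Icc r (‖C‖ + 1) := by
      intro ε hε x hx
      have hsa : IsSelfAdjoint (C + ε • (1 : H →L[ℂ] H)) :=
        (hC.add_nonneg (smul_nonneg hε.1 zero_le_one)).isSelfAdjoint
      constructor
      · exact (algebraMap_le_iff_le_spectrum (ha := hsa)).1
          (hrC.trans (le_add_of_nonneg_right (smul_nonneg hε.1 zero_le_one))) x hx
      · refine (le_algebraMap_iff_spectrum_le (ha := hsa)).1 ?_ x hx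
        rw [map_add, map_one]
        refine add_le_add hC.isSelfAdjoint.le_algebraMap_norm_self ?_
        simpa using smul_le_smul_of_nonneg_right hε.2 (zero_le_one (α := H →L[ℂ] H))
    have hev : ∀ᶠ ε : ℝ in 𝓝[>] 0, ε ∈ Set.Icc (0 : ℝ) 1 :=
      Filter.mem_of_superset (Ioc_mem_nhdsGT one_pos) Set.Ioc_subset_Icc_self
    refine Filter.Tendsto.cfc (p := IsSelfAdjoint) (isCompact_Icc (a := r) (b := ‖C‖ + 1)) f ?_
      (hev.mono hsub) (hev.mono fun ε hε => ?_) ?_ hC.isSelfAdjoint ?_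
    · refine Filter.Tendsto.mono_left ?_ nhdsWithin_le_nhds
      have : Continuous fun ε : ℝ => C + ε • (1 : H →L[ℂ] H) := by fun_prop
      simpa using this.tendsto 0
    · exact (hC.add_nonneg (smul_nonneg hε.1 zero_le_one)).isSelfAdjoint
    · simpa using hsub 0 ⟨le_rfl, zero_le_one⟩
    · exact hf.1.mono fun x hx => hr.trans_le hx.1
  refine ge_of_tendsto hlim ?_
  filter_upwards [self_mem_nhdsWithin] with ε hε
  exact hf.opArith_cfc_le_cfc_add hA hB hv hε

theorem isStrictlyPositive_cfc (hf : IsOperatorMonotone.{u} f) (hfpos : ∀ x, 0 < x → 0 < f x)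
    {A : H →L[ℂ] H} (hA : IsStrictlyPositive A) : IsStrictlyPositive (cfc f A) :=
  (cfc_isStrictlyPositive_iff f A (hf.1.mono fun x hx => hA.spectrum_pos hx)
    hA.isSelfAdjoint).2 fun x hx => hfpos x (hA.spectrum_pos hx)

/-- Functional calculus of the adjoint function `x ↦ 1 / f (1 / x)`. -/
theorem cfc_inv_comp_inv (hf : ContinuousOn f (Set.Ioi 0)) (hfpos : ∀ x, 0 < x → 0 < f x)
    {A : H →L[ℂ] H} (hA : IsStrictlyPositive A) :
    cfc (fun x => (f x⁻¹)⁻¹) A = Ring.inverse (cfc f (Ring.inverse A)) := by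
  have hpos : ∀ x ∈ spectrum ℝ A, 0 < x⁻¹ := fun x hx => inv_pos.2 (hA.spectrum_pos hx)
  have hinv : ContinuousOn (fun x : ℝ => x⁻¹) (spectrum ℝ A) :=
    continuousOn_id.inv₀ fun x hx => (hA.spectrum_pos hx).ne'
  rw [cfc_inv (fun x => f x⁻¹) A (fun x hx => (hfpos _ (hpos x hx)).ne')
      (hf.comp hinv hpos) hA.isSelfAdjoint]
  obtain ⟨u, rfl⟩ := hA.isUnit
  rw [cfc_comp_inv f u (hf.mono (by rintro _ ⟨x, hx, rfl⟩; exact hpos x hx)) hA.isSelfAdjoint,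
    Ring.inverse_unit]

/-- The adjoint function `x ↦ 1 / f (1 / x)` of a positive operator monotone function is operator
monotone. -/
theorem inv_comp_inv (hf : IsOperatorMonotone.{u} f) (hfpos : ∀ x, 0 < x → 0 < f x) :
    IsOperatorMonotone.{u} fun x => (f x⁻¹)⁻¹ := by
  refine ⟨?_, fun K _ _ _ A B hA hB hAB => ?_⟩
  · refine ContinuousOn.inv₀ (hf.1.comp (continuousOn_id.inv₀ fun _ hx => ne_of_gt hx)
      fun x hx => Set.mem_Ioi.2 (inv_pos.2 hx)) fun x hx => (hfpos _ (inv_pos.2 hx)).ne'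
  · rw [cfc_inv_comp_inv hf.1 hfpos hA, cfc_inv_comp_inv hf.1 hfpos hB]
    exact CStarAlgebra.ringInverse_le_ringInverse
      (hf.2 _ _ _ hB.ringInverse hA.ringInverse (CStarAlgebra.ringInverse_le_ringInverse hAB hA))
      (hf.isStrictlyPositive_cfc hfpos hB.ringInverse)

/-- A positive operator monotone function at a harmonic mean is at most the harmonic mean of its
values: this is operator concavity of `x ↦ 1 / f (1 / x)` at `A⁻¹` and `B⁻¹`, inverted. -/
theorem cfc_opHarm_le (hf : IsOperatorMonotone.{u} f) (hfpos : ∀ x, 0 < x → 0 < f x)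
    {A B : H →L[ℂ] H} (hA : IsStrictlyPositive A) (hB : IsStrictlyPositive B) {v : ℝ}
    (hv : v ∈ Set.Icc (0 : ℝ) 1) :
    cfc f (opHarm v A B) ≤ opHarm v (cfc f A) (cfc f B) := by
  have hinv {X : H →L[ℂ] H} (hX : IsStrictlyPositive X) :
      Ring.inverse (Ring.inverse X) = X := by
    obtain ⟨u, rfl⟩ := hX.isUnit
    rw [Ring.inverse_unit, Ring.inverse_unit, inv_inv]
  have key := (hf.inv_comp_inv hfpos).opArith_cfc_le hA.ringInverse hB.ringInverse hv
  rw [cfc_inv_comp_inv hf.1 hfpos hA.ringInverse, cfc_inv_comp_inv hf.1 hfpos hB.ringInverse,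
    cfc_inv_comp_inv hf.1 hfpos (hA.ringInverse.opArith hv hB.ringInverse), hinv hA, hinv hB] at key
  change _ ≤ Ring.inverse (cfc f (opHarm v A B)) at key
  have hfA := hf.isStrictlyPositive_cfc hfpos hA
  have hfB := hf.isStrictlyPositive_cfc hfpos hB
  have := CStarAlgebra.ringInverse_le_ringInverse key
    (hfA.ringInverse.opArith hv hfB.ringInverse)
  rwa [hinv (hf.isStrictlyPositive_cfc hfpos (hA.opHarm hv hB))] at this

end IsOperatorMonotone

/-! ### Comparison of means of the values -/

theorem corollary7 {H : Type u} [NormedAddCommGroup H] [InnerProductSpace ℂ H]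
    [CompleteSpace H] (A B : H →L[ℂ] H) (m M : ℝ) (hm : 0 < m) (hmM : m < M)
    (hmA : m • (1 : H →L[ℂ] H) ≤ A) (hAM : A ≤ M • (1 : H →L[ℂ] H))
    (hmB : m • (1 : H →L[ℂ] H) ≤ B) (hBM : B ≤ M • (1 : H →L[ℂ] H))
    (v : ℝ) (hv : v ∈ Set.Icc (0 : ℝ) 1)
    (σ τ : (H →L[ℂ] H) → (H →L[ℂ] H) → (H →L[ℂ] H))
    (hσ : IsOperatorMean σ) (hτ : IsOperatorMean τ)
    (hσv : BetweenHarmArith v σ) (hτv : BetweenHarmArith v τ)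
    (f : ℝ → ℝ) (hfpos : ∀ x, 0 < x → 0 < f x) (hf : IsOperatorMonotone.{u} f) :
    σ (cfc f A) (cfc f B) ≤ cfc f (constL v m M • τ A B) ∧
      cfc f ((constL v m M)⁻¹ • σ A B) ≤ τ (cfc f A) (cfc f B) := by
  have hA : IsStrictlyPositive A := (isStrictlyPositive_one.smul hm).of_le hmA
  have hB : IsStrictlyPositive B := (isStrictlyPositive_one.smul hm).of_le hmB
  have hfA := hf.isStrictlyPositive_cfc hfpos hA
  have hfB := hf.isStrictlyPositive_cfc hfpos hB
  have hharm := hA.opHarm hv hB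
  have hτAB : IsStrictlyPositive (τ A B) := hharm.of_le (hτv A B hA hB).1
  have hσAB : IsStrictlyPositive (σ A B) := hharm.of_le (hσv A B hA hB).1
  have hratio := arithHarmRatio_le_constL hv hm hmM
  have hL : 0 < constL v m M := (arithHarmRatio_pos hv hm (hm.trans hmM)).trans_le hratio
  have hreverse : opArith v A B ≤ constL v m M • opHarm v A B :=
    (opArith_le_smul_opHarm hm hmM hmA hAM hmB hBM hv).trans
      (smul_le_smul_of_nonneg_right hratio hharm.nonneg)
  constructor
  · calc σ (cfc f A) (cfc f B) ≤ opArith v (cfc f A) (cfc f B) := (hσv _ _ hfA hfB).2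
      _ ≤ cfc f (opArith v A B) := hf.opArith_cfc_le hA hB hv
      _ ≤ cfc f (constL v m M • τ A B) :=
        hf.2 _ _ _ (hA.opArith hv hB) (hτAB.smul hL) <| hreverse.trans <|
          smul_le_smul_of_nonneg_left (hτv A B hA hB).1 hL.le
  · calc cfc f ((constL v m M)⁻¹ • σ A B) ≤ cfc f (opHarm v A B) := by
          refine hf.2 _ _ _ (hσAB.smul (inv_pos.2 hL)) hharm ?_
          calc (constL v m M)⁻¹ • σ A B
              ≤ (constL v m M)⁻¹ • constL v m M • opHarm v A B :=
                smul_le_smul_of_nonneg_left ((hσv A B hA hB).2.trans hreverse)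
                  (inv_nonneg.2 hL.le)
            _ = opHarm v A B := inv_smul_smul₀ hL.ne' _
      _ ≤ opHarm v (cfc f A) (cfc f B) := hf.cfc_opHarm_le hfpos hA hB hv
      _ ≤ τ (cfc f A) (cfc f B) := (hτv _ _ hfA hfB).1
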